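/- Let $n\ge 2$ and $m\ge 3$, and let $w_1,\dots,w_{n+1}\in\mathbb R^n$ be a regular simplex frame: $w_i^{\mathsf T}w_i=1$ for all $i$ and $w_i^{\mathsf T}w_j=-1/n$ for $i\ne j$. Let $S=\sum_{i=1}^{n+1}w_i^{\circ m}$ be the regular simplex tensor of order $m$, where $a^{\circ m}$ has entries $a_{i_1}\cdots a_{i_m}$. For a tensor $S=(s_{i_1,\dots,i_m})$ and $v\in\mathbb R^n$, write $Sv^{m-1}$ for the vector with entries $\sum_{i_2,\dots,i_m}s_{j,i_2,\dots,i_m}v_{i_2}\cdots v_{i_m}$ and $Sv^{m-2}$ for the matrix with entries $\sum_{i_3,\dots,i_m}s_{i,j,i_3,\dots,i_m}v_{i_3}\cdots v_{i_m}$. A (real) eigenpair of $S$ is a pair $(\lambda,v)\in\mathbb R\times\mathbb R^n$ with $Sv^{m-1}=\lambda v$ and $v^{\mathsf T}v=1$. It is robust if $\lambda\ne0$ and the spectral radius of $J(v)=\frac{m-1}{\lambda}\left(Sv^{m-2}-\lambda vv^{\mathsf T}\right)$ is less than $1$; then $v$ is called a robust eigenvector. (1) If $n+m\ge 7$, the robust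 eigenvectors of $S$ are exactly the vectors $\pm w_j$, $1\le j\le n+1$; if $n+m<7$, there are no robust eigenvectors. (2) If only eigenpairs with $\lambda>0$ are considered and $n+m\ge7$, the robust eigenvectors are exactly the frame vectors $w_j$ when $m$ is odd, and exactly the vectors $\pm w_j$ when $m$ is even; if $n+m<7$, there are none. (3) For each $j$, $w_j$ is an eigenvector with eigenvalue $\lambda=1+\frac{n}{(-n)^m}>0$. The eigenvalues of $J(w_j)$, counted with multiplicity, are $0$ (once) and $\frac{(n+1)(m-1)}{1+(-n)^{m-2}n}$ ($n-1$ times). Consequently $$\rho(J(w_j))=\begin{cases}\dfrac{(n+1)(m-1)}{n^{m-1}-1}, & m\text{ odd},\\[2mm] \dfrac{(n+1)(m-1)}{n^{m-1}+1}, & m\text{ even}.\end{cases}$$ -/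

import Mathlib

/-- Real tensors of order `m` and dimension `n`, as arrays `s_{i₁,…,i_m}` of real entries. -/
abbrev RTensor (m n : ℕ) : Type := (Fin m → Fin n) → ℝ

/-- The `m`-fold outer power `a ∘ a ∘ ⋯ ∘ a`, with entries `a_{i₁} a_{i₂} ⋯ a_{i_m}`. -/
def outerPower {n : ℕ} (m : ℕ) (a : Fin n → ℝ) : RTensor m n :=
  fun idx => ∏ k, a (idx k)

/-- The vector `S v^{m-1}` (for `m ≥ 1`):
`(S v^{m-1})_j = ∑_{i₂,…,i_m} s_{j,i₂,…,i_m} v_{i₂} ⋯ v_{i_m}`. -/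
def RTensor.applyVec {m n : ℕ} (S : RTensor m n) (v : Fin n → ℝ) : Fin n → ℝ :=
  fun j => ∑ idx : Fin (m - 1) → Fin n,
    S (fun k => if h : k.val = 0 then j
      else idx ⟨k.val - 1, by have := k.isLt; omega⟩) * ∏ k, v (idx k)

/-- The matrix `S v^{m-2}` (for `m ≥ 2`):
`(S v^{m-2})_{i,j} = ∑_{i₃,…,i_m} s_{i,j,i₃,…,i_m} v_{i₃} ⋯ v_{i_m}`. -/
def RTensor.applyMat {m n : ℕ} (S : RTensor m n) (v : Fin n → ℝ) :
    Matrix (Fin n) (Fin n) ℝ :=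
  Matrix.of fun i j => ∑ idx : Fin (m - 2) → Fin n,
    S (fun k => if h₀ : k.val = 0 then i else if h₁ : k.val = 1 then j
      else idx ⟨k.val - 2, by have := k.isLt; omega⟩) * ∏ k, v (idx k)

/-- `(ev, v)` is a (real) eigenpair of `S`: `S v^{m-1} = ev • v` and `vᵀ v = 1`. -/
def IsEigenpair {m n : ℕ} (S : RTensor m n) (ev : ℝ) (v : Fin n → ℝ) : Prop :=
  S.applyVec v = ev • v ∧ v ⬝ᵥ v = 1

/-- The Jacobian matrix `J(v) = (m-1)/ev • (S v^{m-2} - ev • v vᵀ)` at an eigenpair `(ev, v)`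
with `ev ≠ 0`. -/
noncomputable def jacobianAt {m n : ℕ} (S : RTensor m n) (ev : ℝ) (v : Fin n → ℝ) :
    Matrix (Fin n) (Fin n) ℝ :=
  (((m : ℝ) - 1) / ev) • (S.applyMat v - ev • Matrix.vecMulVec v v)

/-- The spectral radius of a real square matrix: the maximal modulus of its complex eigenvalues. -/
noncomputable def matrixSpectralRadius {n : ℕ} (A : Matrix (Fin n) (Fin n) ℝ) : ENNReal :=
  spectralRadius ℂ (A.map (fun x : ℝ => (x : ℂ)))

/-- A robust eigenpair: an eigenpair with nonzero eigenvalue at which the spectral radius of the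
Jacobian matrix is less than `1`. -/
def IsRobustEigenpair {m n : ℕ} (S : RTensor m n) (ev : ℝ) (v : Fin n → ℝ) : Prop :=
  IsEigenpair S ev v ∧ ev ≠ 0 ∧ matrixSpectralRadius (jacobianAt S ev v) < 1

/-- A robust eigenvector: the vector of some robust eigenpair. -/
def IsRobustEigenvector {m n : ℕ} (S : RTensor m n) (v : Fin n → ℝ) : Prop :=
  ∃ ev : ℝ, IsRobustEigenpair S ev v

/-- A regular simplex frame: `n + 1` unit vectors in `ℝⁿ` with pairwise inner products `-1/n`. -/
def IsRegularSimplexFrame {n : ℕ} (w : Fin (n + 1) → Fin n → ℝ) : Prop :=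
  (∀ i, w i ⬝ᵥ w i = 1) ∧ ∀ i j, i ≠ j → w i ⬝ᵥ w j = -1 / (n : ℝ)

/-- The regular simplex tensor `S = ∑_{i=1}^{n+1} w_i^{∘ m}`. -/
def simplexTensor {n : ℕ} (m : ℕ) (w : Fin (n + 1) → Fin n → ℝ) : RTensor m n :=
  fun idx => ∑ i, outerPower m (w i) idx

open Matrix Polynomial

/-! Work in the frame coordinates `x i = w i ⬝ᵥ v`. The frame is tight and sums to zero, so vectors
of `ℝⁿ` correspond to zero-sum families `x`. With `N = m - 1` and `μ = ev * n / (n + 1)`, the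
eigenpair equation says that every `x i` solves `t ^ N = μ * t + c` for one constant `c`
(`pow_dotProduct_eq`).

For `ev > 0`, robustness makes `1 - J` positive definite, hence `∑ (N * x i ^ (N - 1) - μ) * y i ^ 2
< 0` for every nonzero `y` orthogonal to `1` and to `x` (`second_order_of_isRobustEigenpair`). This
excludes three distinct values: by strict convexity if `N` is even, by nonnegativity of a fifth
divided difference if `N` is odd. It also excludes two values each taken twice, by the mean value
theorem. So all coordinates but one agree, and the normalization leaves only `v = ± w j`. Negative
eigenvalues occur only for odd `m` and reduce to positive ones by `v ↦ -v`.

Conversely, the Jacobian at `w j` is a multiple `θ` of the projection onto the complement of `w j`,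
and `|θ| < 1` amounts to `7 ≤ n + m`. -/

/-! ### Contractions of the simplex tensor. -/

theorem RTensor.applyVec_simplexTensor {n m : ℕ} (hm : 1 ≤ m) (w : Fin (n + 1) → Fin n → ℝ)
    (v : Fin n → ℝ) :
    (simplexTensor m w).applyVec v = ∑ i, (w i ⬝ᵥ v) ^ (m - 1) • w i := by
  obtain ⟨k, rfl⟩ : ∃ k, m = k + 1 := ⟨m - 1, by omega⟩
  ext j
  simp only [RTensor.applyVec, simplexTensor, outerPower, Finset.sum_mul, Finset.sum_apply,
    Pi.smul_apply, smul_eq_mul, dotProduct, Nat.add_sub_cancel, Fintype.sum_pow]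
  rw [Finset.sum_comm]
  refine Finset.sum_congr rfl fun i _ => Finset.sum_congr rfl fun idx _ => ?_
  rw [Fin.prod_univ_succ]
  simp [Finset.prod_mul_distrib]
  ring

theorem RTensor.applyMat_simplexTensor {n m : ℕ} (hm : 2 ≤ m) (w : Fin (n + 1) → Fin n → ℝ)
    (v : Fin n → ℝ) :
    (simplexTensor m w).applyMat v =
      ∑ i, (w i ⬝ᵥ v) ^ (m - 2) • vecMulVec (w i) (w i) := by
  obtain ⟨k, rfl⟩ : ∃ k, m = k + 2 := ⟨m - 2, by omega⟩
  ext a b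
  simp only [RTensor.applyMat, simplexTensor, outerPower, Finset.sum_mul, Matrix.sum_apply,
    Matrix.smul_apply, smul_eq_mul, dotProduct, Nat.add_sub_cancel, Fintype.sum_pow, of_apply,
    vecMulVec_apply]
  rw [Finset.sum_comm]
  refine Finset.sum_congr rfl fun i _ => Finset.sum_congr rfl fun (idx : Fin k → Fin n) _ => ?_
  rw [Fin.prod_univ_succ, Fin.prod_univ_succ]
  change _ * ∏ l : Fin k, v (idx l) = _
  simp [Finset.prod_mul_distrib]
  ring

theorem dotProduct_sum_smul_mulVec_self {ι : Type*} [Fintype ι] {n : ℕ} (c : ι → ℝ)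
    (w : ι → Fin n → ℝ) (u : Fin n → ℝ) :
    u ⬝ᵥ (∑ i, c i • vecMulVec (w i) (w i)) *ᵥ u = ∑ i, c i * (w i ⬝ᵥ u) ^ 2 := by
  rw [Matrix.sum_mulVec, dotProduct_sum]
  refine Finset.sum_congr rfl fun i _ => ?_
  rw [smul_mulVec, dotProduct_smul, vecMulVec_mulVec]
  simp [dotProduct_comm u (w i), pow_two]

/-! ### Tight frame identities. -/

namespace IsRegularSimplexFrame

variable {n : ℕ} {w : Fin (n + 1) → Fin n → ℝ}

theorem dotProduct_eq (hw : IsRegularSimplexFrame w) (hn : n ≠ 0) (i j : Fin (n + 1)) :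
    w i ⬝ᵥ w j = (if i = j then ((n : ℝ) + 1) / n else 0) - 1 / n := by
  have : (n : ℝ) ≠ 0 := by exact_mod_cast hn
  split_ifs with h
  · subst h; rw [hw.1]; field_simp; ring
  · rw [hw.2 i j h]; ring

theorem dotProduct_sum_smul (hw : IsRegularSimplexFrame w) (hn : n ≠ 0) (y : Fin (n + 1) → ℝ)
    (hy : ∑ i, y i = 0) (j : Fin (n + 1)) :
    w j ⬝ᵥ ∑ i, y i • w i = ((n : ℝ) + 1) / n * y j := by
  simp only [dotProduct_sum, dotProduct_smul, hw.dotProduct_eq hn, smul_eq_mul, mul_sub,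
    Finset.sum_sub_distrib, ← Finset.sum_mul, hy]
  simp
  ring

theorem sum_eq_zero (hw : IsRegularSimplexFrame w) (hn : n ≠ 0) : ∑ i, w i = 0 := by
  have h0 : (n : ℝ) ≠ 0 := by exact_mod_cast hn
  rw [← dotProduct_self_eq_zero]
  simp only [sum_dotProduct, dotProduct_sum, hw.dotProduct_eq hn]
  simp
  field_simp
  simp

/-- The frame operator `T` is symmetric with `T * T = c • T`, so `T - c • 1` has squared Frobenius
norm `c * (c * n - trace T)`. This vanishes because `trace T = n + 1 = c * n`; no spanning argument
is needed. -/
theorem sum_vecMulVec (hw : IsRegularSimplexFrame w) (hn : n ≠ 0) :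
    ∑ i, vecMulVec (w i) (w i) = (((n : ℝ) + 1) / n) • (1 : Matrix (Fin n) (Fin n) ℝ) := by
  have h0 : (n : ℝ) ≠ 0 := by exact_mod_cast hn
  have h1 : (n : ℝ) + 1 ≠ 0 := by positivity
  set T := ∑ i, vecMulVec (w i) (w i) with hT
  set c := ((n : ℝ) + 1) / n with hc
  have hc0 : c ≠ 0 := by positivity
  have hTw (i) : T *ᵥ w i = c • w i := by
    simp only [hT, Matrix.sum_mulVec, vecMulVec_mulVec, hw.dotProduct_eq hn]
    ext k
    have := congrFun (hw.sum_eq_zero hn) k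
    simp only [Finset.sum_apply, Pi.zero_apply] at this
    simp [mul_sub, Finset.sum_sub_distrib, ← Finset.sum_mul, this]
    ring
  have hTT : T * T = c • T := by
    conv_lhs => rw [hT, Finset.mul_sum]
    rw [hT, Finset.smul_sum]
    refine Finset.sum_congr rfl fun i _ => ?_
    rw [mul_vecMulVec, hTw, smul_vecMulVec]
  have hTt : Tᵀ = T := by simp [hT, Matrix.transpose_sum, transpose_vecMulVec]
  have htr : T.trace = n + 1 := by
    simp [hT, Matrix.trace_sum, Matrix.trace_vecMulVec, hw.1]
  have key : (T - c • 1)ᴴ * (T - c • 1) = c • (c • 1 - T) := by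
    rw [conjTranspose_eq_transpose_of_trivial, transpose_sub, hTt, transpose_smul, transpose_one]
    simp only [Matrix.sub_mul, Matrix.mul_sub, hTT, Matrix.smul_mul, Matrix.mul_smul,
      Matrix.one_mul, Matrix.mul_one, smul_sub]
    abel
  have : ((T - c • 1)ᴴ * (T - c • 1)).trace = 0 := by
    rw [key, trace_smul, trace_sub, trace_smul, trace_one, htr, hc]
    simp
    right
    field_simp
    ring
  rw [trace_conjTranspose_mul_self_eq_zero_iff] at this
  exact sub_eq_zero.1 this

theorem sum_dotProduct_smul (hw : IsRegularSimplexFrame w) (hn : n ≠ 0) (v : Fin n → ℝ) :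
    ∑ i, (w i ⬝ᵥ v) • w i = (((n : ℝ) + 1) / n) • v := by
  have := congrArg (· *ᵥ v) (hw.sum_vecMulVec hn)
  simpa [Matrix.sum_mulVec, vecMulVec_mulVec, smul_mulVec] using this

theorem sum_dotProduct_mul_dotProduct (hw : IsRegularSimplexFrame w) (hn : n ≠ 0)
    (u v : Fin n → ℝ) :
    ∑ i, (w i ⬝ᵥ u) * (w i ⬝ᵥ v) = ((n : ℝ) + 1) / n * (u ⬝ᵥ v) := by
  have := congrArg (· ⬝ᵥ v) (hw.sum_dotProduct_smul hn u)
  simpa [sum_dotProduct] using this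

theorem sum_dotProduct_eq_zero (hw : IsRegularSimplexFrame w) (hn : n ≠ 0) (v : Fin n → ℝ) :
    ∑ i, w i ⬝ᵥ v = 0 := by
  rw [← sum_dotProduct, hw.sum_eq_zero hn, zero_dotProduct]

theorem eq_of_dotProduct_eq (hw : IsRegularSimplexFrame w) (hn : n ≠ 0) {u v : Fin n → ℝ}
    (h : ∀ i, w i ⬝ᵥ u = w i ⬝ᵥ v) : u = v := by
  have h1 : ((n : ℝ) + 1) / n ≠ 0 := by positivity
  refine smul_right_injective _ h1 ?_
  simp only [← hw.sum_dotProduct_smul hn, h]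

end IsRegularSimplexFrame

/-! ### Hermite interpolation at three doubled nodes. -/

/-- The quintic vanishing simply at `x` and doubly at `y` and `z`. -/
noncomputable def hermiteQuintic (x y z : ℝ) : ℝ[X] := (X - C x) * (X - C y) ^ 2 * (X - C z) ^ 2

theorem iterate_derivative_hermiteQuintic (x y z : ℝ) :
    derivative^[5] (hermiteQuintic x y z) = 120 := by
  have hdeg : (hermiteQuintic x y z).Monic ∧ (hermiteQuintic x y z).natDegree = 5 := by
    have h1 : (hermiteQuintic x y z).Monic :=
      ((monic_X_sub_C x).mul ((monic_X_sub_C y).pow 2)).mul ((monic_X_sub_C z).pow 2)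
    refine ⟨h1, ?_⟩
    rw [hermiteQuintic, Monic.natDegree_mul ((monic_X_sub_C x).mul ((monic_X_sub_C y).pow 2))
      ((monic_X_sub_C z).pow 2), Monic.natDegree_mul (monic_X_sub_C x) ((monic_X_sub_C y).pow 2)]
    simp
  have hd : (derivative^[5] (hermiteQuintic x y z)).natDegree ≤ 0 := by
    have := natDegree_iterate_derivative (hermiteQuintic x y z) 5
    omega
  rw [eq_C_of_natDegree_le_zero hd, coeff_iterate_derivative]
  have : (hermiteQuintic x y z).coeff (0 + 5) = 1 := by
    have := hdeg.1.coeff_natDegree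
    rwa [hdeg.2] at this
  rw [this]
  simp only [zero_add, nsmul_eq_mul, mul_one, show Nat.descFactorial 5 5 = 120 from rfl]
  exact map_natCast (C : ℝ →+* ℝ[X]) 120

theorem eval_hermiteQuintic_left (x y z : ℝ) : (hermiteQuintic x y z).eval x = 0 := by
  simp [hermiteQuintic]

theorem eval_hermiteQuintic_mid (x y z : ℝ) : (hermiteQuintic x y z).eval y = 0 := by
  simp [hermiteQuintic]

theorem eval_hermiteQuintic_right (x y z : ℝ) : (hermiteQuintic x y z).eval z = 0 := by
  simp [hermiteQuintic]

theorem eval_derivative_hermiteQuintic_left (x y z : ℝ) :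
    (derivative (hermiteQuintic x y z)).eval x = (x - y) ^ 2 * (x - z) ^ 2 := by
  simp [hermiteQuintic, derivative_pow]

theorem eval_derivative_hermiteQuintic_mid (x y z : ℝ) :
    (derivative (hermiteQuintic x y z)).eval y = 0 := by
  simp [hermiteQuintic, derivative_pow]

theorem eval_derivative_hermiteQuintic_right (x y z : ℝ) :
    (derivative (hermiteQuintic x y z)).eval z = 0 := by
  simp [hermiteQuintic, derivative_pow]

/-- Rolle's theorem with multiplicity: six roots, and each derivative loses at most one. -/
theorem exists_iterate_derivative_five_eval_eq_zero {F : ℝ[X]} {a b d : ℝ} (hab : a ≠ b)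
    (hbd : b ≠ d) (had : a ≠ d) (ha : F.eval a = 0) (hb : F.eval b = 0) (hd : F.eval d = 0)
    (ha' : (derivative F).eval a = 0) (hb' : (derivative F).eval b = 0)
    (hd' : (derivative F).eval d = 0) : ∃ x, (derivative^[5] F).eval x = 0 := by
  by_cases hF : F = 0
  · exact ⟨0, by rw [hF, iterate_derivative_zero, eval_zero]⟩
  have hr (x : ℝ) (h0 : F.eval x = 0) (h1 : (derivative F).eval x = 0) :
      2 ≤ F.roots.count x := by
    rw [count_roots]
    exact (one_lt_rootMultiplicity_iff_isRoot hF).2 ⟨h0, h1⟩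
  have hle : ({a, a, b, b, d, d} : Multiset ℝ) ≤ F.roots := by
    rw [Multiset.le_iff_count]
    intro x
    simp only [Multiset.insert_eq_cons, Multiset.count_cons, Multiset.count_singleton]
    by_cases h1 : x = a
    · subst h1; simpa [hab, had] using hr x ha ha'
    by_cases h2 : x = b
    · subst h2; simpa [h1, hbd] using hr x hb hb'
    by_cases h3 : x = d
    · subst h3; simpa [h1, h2] using hr x hd hd'
    simp [h1, h2, h3]
  have h6 : 6 ≤ F.roots.card := by simpa using Multiset.card_le_card hle
  have hder (k : ℕ) : 6 ≤ (derivative^[k] F).roots.card + k := by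
    induction k with
    | zero => exact h6
    | succ k ih =>
      have := card_roots_le_derivative (derivative^[k] F)
      rw [Function.iterate_succ_apply']
      omega
  have h1 := hder 5
  obtain ⟨x, hx⟩ := Multiset.card_pos_iff_exists_mem.1
    (show 0 < (derivative^[5] F).roots.card by omega)
  exact ⟨x, isRoot_of_mem_roots hx⟩

/-- The fifth divided difference, at three doubled nodes, of an odd power minus its affine
interpolant is nonnegative. -/
theorem sum_deriv_mul_sq_nonneg_of_odd {N : ℕ} (hN : Odd N) {μ c a b d : ℝ} (hab : a ≠ b)
    (hbd : b ≠ d) (had : a ≠ d) (ha : a ^ N = μ * a + c) (hb : b ^ N = μ * b + c)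
    (hd : d ^ N = μ * d + c) :
    0 ≤ (N * a ^ (N - 1) - μ) * (d - b) ^ 2 + (N * b ^ (N - 1) - μ) * (d - a) ^ 2 +
      (N * d ^ (N - 1) - μ) * (b - a) ^ 2 := by
  have hab' := sub_ne_zero.2 hab
  have hbd' := sub_ne_zero.2 hbd
  have had' := sub_ne_zero.2 had
  have hba' := sub_ne_zero.2 hab.symm
  have hdb' := sub_ne_zero.2 hbd.symm
  have hda' := sub_ne_zero.2 had.symm
  generalize hpa : N * a ^ (N - 1) - μ = pa
  generalize hpb : N * b ^ (N - 1) - μ = pb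
  generalize hpd : N * d ^ (N - 1) - μ = pd
  -- `A`, `B`, `D` are the coefficients for which the combination of quintics matches `t ^ N - μ * t
  -- - c` in value and slope at the three nodes.
  obtain ⟨A, hA⟩ : ∃ A, pa = A * ((a - b) ^ 2 * (a - d) ^ 2) :=
    ⟨pa / ((a - b) ^ 2 * (a - d) ^ 2), by field_simp⟩
  obtain ⟨B, hB⟩ : ∃ B, pb = B * ((b - a) ^ 2 * (b - d) ^ 2) :=
    ⟨pb / ((b - a) ^ 2 * (b - d) ^ 2), by field_simp⟩
  obtain ⟨D, hD⟩ : ∃ D, pd = D * ((d - a) ^ 2 * (d - b) ^ 2) :=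
    ⟨pd / ((d - a) ^ 2 * (d - b) ^ 2), by field_simp⟩
  have hF0 (x : ℝ) : (X ^ N - C μ * X - C c - (C A * hermiteQuintic a b d
      + C B * hermiteQuintic b a d + C D * hermiteQuintic d a b)).eval x
      = x ^ N - μ * x - c - (A * (hermiteQuintic a b d).eval x
        + B * (hermiteQuintic b a d).eval x + D * (hermiteQuintic d a b).eval x) := by
    simp
  have hF1 (x : ℝ) : (derivative (X ^ N - C μ * X - C c - (C A * hermiteQuintic a b d
      + C B * hermiteQuintic b a d + C D * hermiteQuintic d a b))).eval x
      = N * x ^ (N - 1) - μ - (A * (derivative (hermiteQuintic a b d)).eval x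
        + B * (derivative (hermiteQuintic b a d)).eval x
        + D * (derivative (hermiteQuintic d a b)).eval x) := by
    simp [derivative_X_pow]
  have hsum : 0 ≤ A + B + D := by
    obtain ⟨x, hx⟩ := exists_iterate_derivative_five_eval_eq_zero hab hbd had
      (F := X ^ N - C μ * X - C c - (C A * hermiteQuintic a b d + C B * hermiteQuintic b a d
        + C D * hermiteQuintic d a b))
      (by rw [hF0]; simp only [eval_hermiteQuintic_left, eval_hermiteQuintic_mid]; linarith)
      (by rw [hF0]; simp only [eval_hermiteQuintic_left, eval_hermiteQuintic_mid,
            eval_hermiteQuintic_right]; linarith)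
      (by rw [hF0]; simp only [eval_hermiteQuintic_left, eval_hermiteQuintic_right]; linarith)
      (by rw [hF1, hpa, hA]; simp only [eval_derivative_hermiteQuintic_left,
            eval_derivative_hermiteQuintic_mid]; ring)
      (by rw [hF1, hpb, hB]; simp only [eval_derivative_hermiteQuintic_left,
            eval_derivative_hermiteQuintic_mid, eval_derivative_hermiteQuintic_right]; ring)
      (by rw [hF1, hpd, hD]; simp only [eval_derivative_hermiteQuintic_left,
            eval_derivative_hermiteQuintic_right]; ring)
    have hlin : derivative^[5] (C μ * X : ℝ[X]) = 0 := by
      rw [iterate_derivative_C_mul, iterate_derivative_X (by norm_num), mul_zero]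
    have hconst : derivative^[5] (C c : ℝ[X]) = 0 := iterate_derivative_C (by norm_num)
    simp only [iterate_derivative_sub, iterate_map_add, iterate_derivative_C_mul,
      iterate_derivative_hermiteQuintic, iterate_derivative_X_pow_eq_C_mul, hlin, hconst] at hx
    generalize hk : N.descFactorial 5 = k at hx
    simp only [eval_sub, eval_add, eval_mul, eval_C, eval_pow, eval_X, eval_zero,
      eval_ofNat] at hx
    -- The fifth derivative of `t ^ N` is nonnegative: for `N < 5` its coefficient vanishes,
    -- otherwise `N - 5` is even.
    have hpow : 0 ≤ (k : ℝ) * x ^ (N - 5) := by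
      rcases lt_or_ge N 5 with h | h
      · rw [← hk, Nat.descFactorial_of_lt h, Nat.cast_zero, zero_mul]
      · exact mul_nonneg (Nat.cast_nonneg _) ((Nat.Odd.sub_odd hN (by decide)).pow_nonneg _)
    linarith
  have : pa * (d - b) ^ 2 + pb * (d - a) ^ 2 + pd * (b - a) ^ 2
      = (A + B + D) * ((a - b) ^ 2 * (b - d) ^ 2 * (a - d) ^ 2) := by
    rw [hA, hB, hD]
    ring
  rw [this]
  positivity

theorem Fintype.sum_eq_add_add {ι : Type*} [Fintype ι] [DecidableEq ι] {i j k : ι} (hij : i ≠ j)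
    (hjk : j ≠ k) (hik : i ≠ k) {F : ι → ℝ} (h : ∀ l, l ≠ i → l ≠ j → l ≠ k → F l = 0) :
    ∑ l, F l = F i + F j + F k := by
  have : ∑ l, F l = ∑ l ∈ {i, j, k}, F l := by
    symm
    apply Finset.sum_subset (Finset.subset_univ _)
    intro l _ hl
    simp only [Finset.mem_insert, Finset.mem_singleton, not_or] at hl
    exact h l hl.1 hl.2.1 hl.2.2
  rw [this, Finset.sum_insert (by simp [hij, hik]), Finset.sum_insert (by simp [hjk]),
    Finset.sum_singleton]
  ring

/-! ### A power meeting a line. -/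

theorem Even.not_three_affine_coincidences {N : ℕ} (hN : Even N) (hN0 : N ≠ 0) {μ c a b d : ℝ}
    (hab : a < b) (hbd : b < d) (ha : a ^ N = μ * a + c) (hb : b ^ N = μ * b + c)
    (hd : d ^ N = μ * d + c) : False := by
  have h := (hN.strictConvexOn_pow hN0).slope_strict_mono_adjacent
    (Set.mem_univ a) (Set.mem_univ d) hab hbd
  have h1 : b ^ N - a ^ N = μ * (b - a) := by rw [ha, hb]; ring
  have h2 : d ^ N - b ^ N = μ * (d - b) := by rw [hd, hb]; ring
  simp only [h1, h2] at h
  rw [mul_div_cancel_right₀ _ (sub_pos.2 hab).ne', mul_div_cancel_right₀ _ (sub_pos.2 hbd).ne'] at h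
  exact lt_irrefl _ h

/-- The mean value theorem gives a point between `a` and `b` with slope exactly `μ`. But `N * t ^ (N
- 1)` is convex or monotone, so there it is at most its larger endpoint value, which is below `μ`.
-/
theorem not_deriv_lt_of_affine_coincidences {N : ℕ} {μ c a b : ℝ} (hab : a < b)
    (ha : a ^ N = μ * a + c) (hb : b ^ N = μ * b + c) (ha' : N * a ^ (N - 1) < μ)
    (hb' : N * b ^ (N - 1) < μ) : False := by
  obtain ⟨ξ, hξ, h⟩ := exists_hasDerivAt_eq_slope (fun t : ℝ => t ^ N)
    (fun t => N * t ^ (N - 1)) hab (by fun_prop) (fun t _ => by simpa using hasDerivAt_pow N t)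
  have h1 : b ^ N - a ^ N = μ * (b - a) := by rw [ha, hb]; ring
  simp only [h1] at h
  rw [mul_div_cancel_right₀ _ (sub_pos.2 hab).ne'] at h
  have hNn : (0 : ℝ) ≤ N := Nat.cast_nonneg N
  rcases Nat.even_or_odd (N - 1) with he | ho
  · have hmax := he.convexOn_pow.le_max_of_mem_Icc (Set.mem_univ a) (Set.mem_univ b)
      (Set.Ioo_subset_Icc_self hξ)
    rcases le_max_iff.1 hmax with h2 | h2
    · have := mul_le_mul_of_nonneg_left h2 hNn
      linarith
    · have := mul_le_mul_of_nonneg_left h2 hNn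
      linarith
  · have := mul_le_mul_of_nonneg_left (ho.strictMono_pow hξ.2).le hNn
    simp only at this
    linarith

/-! ### Value patterns allowed by the second-order condition. -/

section Critical

variable {ι : Type*} [Fintype ι] {N : ℕ} {x : ι → ℝ} {μ c : ℝ}

theorem three_values_false_of_second_order [DecidableEq ι] (hN : 2 ≤ N)
    (hx : ∀ i, x i ^ N = μ * x i + c)
    (hy : ∀ y : ι → ℝ, ∑ i, y i = 0 → ∑ i, x i * y i = 0 → y ≠ 0 →
      ∑ i, (N * x i ^ (N - 1) - μ) * y i ^ 2 < 0) {i j k : ι} (hij : x i ≠ x j)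
    (hjk : x j ≠ x k) (hik : x i ≠ x k) : False := by
  rcases Nat.even_or_odd N with he | ho
  · have hN0 : N ≠ 0 := by omega
    have key {a b d : ι} (hab : x a < x b) (hbd : x b < x d) : False :=
      he.not_three_affine_coincidences hN0 hab hbd (hx a) (hx b) (hx d)
    rcases lt_or_gt_of_ne hij with h1 | h1 <;> rcases lt_or_gt_of_ne hjk with h2 | h2 <;>
      rcases lt_or_gt_of_ne hik with h3 | h3
    exacts [key h1 h2, key h1 h2, key h3 h2, key h3 h1, key h1 h3, key h2 h3, key h2 h1, key h2 h1]
  · have eij : i ≠ j := fun h => hij (by rw [h])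
    have ejk : j ≠ k := fun h => hjk (by rw [h])
    have eik : i ≠ k := fun h => hik (by rw [h])
    -- Up to scale, the only vector supported on `i, j, k` orthogonal to `1` and `x`; its quadratic
    -- form is the divided-difference expression.
    set y : ι → ℝ := fun l => if l = i then x k - x j else if l = j then -(x k - x i)
      else if l = k then x j - x i else 0 with hydef
    have y0 (l : ι) (h1 : l ≠ i) (h2 : l ≠ j) (h3 : l ≠ k) : y l = 0 := by
      simp [hydef, h1, h2, h3]
    have yi : y i = x k - x j := by simp [hydef]
    have yj : y j = -(x k - x i) := by simp [hydef, eij.symm]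
    have yk : y k = x j - x i := by simp [hydef, eik.symm, ejk.symm]
    have := hy y
      (by rw [Fintype.sum_eq_add_add eij ejk eik y0, yi, yj, yk]; ring)
      (by
        rw [Fintype.sum_eq_add_add eij ejk eik (fun l h1 h2 h3 => by rw [y0 l h1 h2 h3, mul_zero]),
          yi, yj, yk]
        ring)
      (fun h => hjk (by have := congrFun h i; rw [yi] at this; exact (sub_eq_zero.1 this).symm))
    rw [Fintype.sum_eq_add_add eij ejk eik (fun l h1 h2 h3 => by rw [y0 l h1 h2 h3]; ring),
      yi, yj, yk, neg_sq] at this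
    have := sum_deriv_mul_sq_nonneg_of_odd ho hij hjk hik (hx i) (hx j) (hx k)
    linarith

theorem deriv_lt_of_eq_of_second_order [DecidableEq ι]
    (hy : ∀ y : ι → ℝ, ∑ i, y i = 0 → ∑ i, x i * y i = 0 → y ≠ 0 →
      ∑ i, (N * x i ^ (N - 1) - μ) * y i ^ 2 < 0) {i j : ι} (hij : i ≠ j) (h : x i = x j) :
    N * x i ^ (N - 1) < μ := by
  -- Orthogonal to `x` exactly because `x i = x j`.
  set y : ι → ℝ := fun l => if l = i then 1 else if l = j then -1 else 0 with hydef
  have y0 (l : ι) (h1 : l ≠ i ∧ l ≠ j) : y l = 0 := by simp [hydef, h1.1, h1.2]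
  have yi : y i = 1 := by simp [hydef]
  have yj : y j = -1 := by simp [hydef, hij.symm]
  have := hy y (by rw [Fintype.sum_eq_add i j hij y0, yi, yj]; ring)
    (by
      rw [Fintype.sum_eq_add i j hij (fun l h1 => by rw [y0 l h1, mul_zero]), yi, yj, h]; ring)
    (fun h => by have := congrFun h i; rw [yi] at this; exact one_ne_zero this)
  rw [Fintype.sum_eq_add i j hij (fun l h1 => by rw [y0 l h1]; ring), yi, yj, h] at this
  rw [h]
  linarith

/-- At most two values occur, so some value repeats; the zero sum forces a second value, and that
one cannot repeat as well. -/
theorem exists_eq_off_of_second_order [DecidableEq ι] (hι : 3 ≤ Fintype.card ι) (hN : 2 ≤ N)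
    (hx : ∀ i, x i ^ N = μ * x i + c) (hsum : ∑ i, x i = 0) (hx0 : x ≠ 0)
    (hy : ∀ y : ι → ℝ, ∑ i, y i = 0 → ∑ i, x i * y i = 0 → y ≠ 0 →
      ∑ i, (N * x i ^ (N - 1) - μ) * y i ^ 2 < 0) :
    ∃ j, ∃ a, ∀ i, i ≠ j → x i = a := by
  obtain ⟨i₀, i₁, hne, heq⟩ : ∃ i j, i ≠ j ∧ x i = x j := by
    obtain ⟨i, j, k, hij, hik, hjk⟩ := Fintype.two_lt_card_iff.1 (show 2 < Fintype.card ι by omega)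
    by_contra! h
    exact three_values_false_of_second_order hN hx hy (h i j hij) (h j k hjk) (h i k hik)
  have hlt := deriv_lt_of_eq_of_second_order hy hne heq
  obtain ⟨j, hj⟩ : ∃ j, x j ≠ x i₀ := by
    by_contra! h
    simp only [h, Finset.sum_const, Finset.card_univ, nsmul_eq_mul, mul_eq_zero,
      Nat.cast_eq_zero] at hsum
    exact hx0 (funext fun i => by rw [h, hsum.resolve_left (by omega)]; rfl)
  refine ⟨j, x i₀, fun i hij => ?_⟩
  by_contra hi
  by_cases hxij : x i = x j
  · have hlt' := deriv_lt_of_eq_of_second_order hy hij hxij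
    rcases lt_or_gt_of_ne hi with h | h
    · exact not_deriv_lt_of_affine_coincidences h (hx i) (hx i₀) hlt' hlt
    · exact not_deriv_lt_of_affine_coincidences h (hx i₀) (hx i) hlt hlt'
  · exact three_values_false_of_second_order hN hx hy hxij hj hi

end Critical

theorem simplex_coordinates_of_eq_off {n : ℕ} (hn : n ≠ 0) {x : Fin (n + 1) → ℝ}
    (hsum : ∑ i, x i = 0) (hsq : ∑ i, x i * x i = ((n : ℝ) + 1) / n) {j : Fin (n + 1)} {a : ℝ}
    (ha : ∀ i, i ≠ j → x i = a) :
    (x j = 1 ∧ ∀ i, i ≠ j → x i = -1 / n) ∨ (x j = -1 ∧ ∀ i, i ≠ j → x i = 1 / n) := by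
  have h0 : (n : ℝ) ≠ 0 := by exact_mod_cast hn
  have hsum' : x j + n * a = 0 := by
    rw [← hsum, ← Finset.add_sum_erase _ _ (Finset.mem_univ j),
      Finset.sum_congr rfl (fun i hi => ha i (Finset.ne_of_mem_erase hi))]
    simp
  have hsq' : x j * x j + n * (a * a) = ((n : ℝ) + 1) / n := by
    rw [← hsq, ← Finset.add_sum_erase _ _ (Finset.mem_univ j),
      Finset.sum_congr rfl (fun i hi => by rw [ha i (Finset.ne_of_mem_erase hi)])]
    simp
  have hxj : x j = -(n * a) := by linarith
  have hna : (n * a) * (n * a) = 1 := by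
    rw [hxj] at hsq'
    field_simp at hsq'
    linear_combination hsq'
  rcases mul_self_eq_one_iff.1 hna with h | h
  · right
    refine ⟨by rw [hxj, h], fun i hi => ?_⟩
    rw [ha i hi]; field_simp; linarith
  · left
    refine ⟨by rw [hxj, h, neg_neg], fun i hi => ?_⟩
    rw [ha i hi]; field_simp; linarith

/-! ### Spectral facts about symmetric matrices. -/

section Spectral
theorem Matrix.charpoly_smul_one_sub_vecMulVec {K : Type*} [Field K] {n : ℕ} (hn : n ≠ 0) (θ : K)
    (u : Fin n → K) (hu : u ⬝ᵥ u = 1) :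
    (θ • (1 - vecMulVec u u)).charpoly = X * (X - C θ) ^ (n - 1) := by
  have h : θ • (1 - vecMulVec u u) = vecMulVec (-θ • u) u - scalar (Fin n) (-θ) := by
    rw [smul_sub, smul_vecMulVec, map_neg, scalar_apply, ← Matrix.smul_one_eq_diagonal, neg_smul]
    abel
  rw [h, charpoly_sub_scalar, charpoly_vecMulVec, smul_dotProduct, hu]
  obtain ⟨k, rfl⟩ := Nat.exists_eq_succ_of_ne_zero hn
  simp [smul_eq_C_mul, pow_succ]
  ring

theorem matrixSpectralRadius_smul_one_sub_vecMulVec {n : ℕ} (hn : 2 ≤ n) (θ : ℝ)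
    (u : Fin n → ℝ) (hu : u ⬝ᵥ u = 1) :
    matrixSpectralRadius (θ • (1 - vecMulVec u u)) = ENNReal.ofReal |θ| := by
  have hmap : (θ • (1 - vecMulVec u u)).map (fun x : ℝ => (x : ℂ)) =
      (θ : ℂ) • (1 - vecMulVec (fun i => (u i : ℂ)) (fun i => (u i : ℂ))) := by
    ext i j
    by_cases h : i = j <;> simp [vecMulVec_apply, h]
  have hu' : (fun i => (u i : ℂ)) ⬝ᵥ (fun i => (u i : ℂ)) = 1 := by
    have := congrArg (fun x : ℝ => (x : ℂ)) hu
    simpa [dotProduct] using this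
  have hspec : spectrum ℂ ((θ : ℂ) • (1 - vecMulVec (fun i => (u i : ℂ)) (fun i => (u i : ℂ))))
      = {0, (θ : ℂ)} := by
    ext z
    rw [mem_spectrum_iff_isRoot_charpoly, charpoly_smul_one_sub_vecMulVec (by omega) _ _ hu']
    -- For `n = 1` the eigenvalue `θ` would be absent.
    have : n - 1 ≠ 0 := by omega
    simp [this, sub_eq_zero]
  rw [matrixSpectralRadius, hmap, spectralRadius, hspec, iSup_insert, iSup_singleton]
  rw [nnnorm_zero, ENNReal.coe_zero, max_eq_right zero_le, ← enorm_eq_nnnorm,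
    ← ofReal_norm, Complex.norm_real,
    Real.norm_eq_abs]

/-- All eigenvalues of the symmetric matrix `A` lie below `1`, so `1 - A` is positive definite. -/
theorem dotProduct_mulVec_lt_of_matrixSpectralRadius_lt_one {n : ℕ}
    {A : Matrix (Fin n) (Fin n) ℝ} (hA : Aᵀ = A) (h : matrixSpectralRadius A < 1)
    {u : Fin n → ℝ} (hu : u ≠ 0) : u ⬝ᵥ A *ᵥ u < u ⬝ᵥ u := by
  have hH : (1 - A).IsHermitian := by
    rw [IsHermitian, conjTranspose_eq_transpose_of_trivial, transpose_sub, hA, transpose_one]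
  have hpos : (1 - A).PosDef := by
    rw [hH.posDef_iff_eigenvalues_pos]
    intro i
    have hmem : hH.eigenvalues i ∈ spectrum ℝ (1 - A) := hH.eigenvalues_mem_spectrum_real i
    set e := hH.eigenvalues i
    have h1 : 1 - e ∈ spectrum ℝ A := by
      rw [spectrum.mem_iff] at hmem ⊢
      intro hun
      apply hmem
      rw [← IsUnit.neg_iff]
      convert hun using 1
      rw [map_sub, map_one]
      abel
    have h2 : ((1 - e : ℝ) : ℂ) ∈ spectrum ℂ (A.map (fun x : ℝ => (x : ℂ))) := by
      rw [mem_spectrum_iff_isRoot_charpoly] at h1 ⊢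
      have : (A.map (fun x : ℝ => (x : ℂ))).charpoly = A.charpoly.map Complex.ofRealHom :=
        A.charpoly_map Complex.ofRealHom
      rw [this]
      exact h1.map (f := Complex.ofRealHom)
    have h3 : (‖((1 - e : ℝ) : ℂ)‖₊ : ENNReal) < 1 :=
      lt_of_le_of_lt (le_iSup₂ (α := ENNReal) (f := fun (k : ℂ) (_ : k ∈ spectrum ℂ _) =>
        (‖k‖₊ : ENNReal)) _ h2) h
    have h4 : ‖((1 - e : ℝ) : ℂ)‖ < 1 := by exact_mod_cast h3
    rw [Complex.norm_real, Real.norm_eq_abs, abs_lt] at h4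
    linarith
  have := hpos.dotProduct_mulVec_pos hu
  simp only [star_trivial, Matrix.sub_mulVec, Matrix.one_mulVec, dotProduct_sub] at this
  linarith

end Spectral

/-! ### Eigenpairs in frame coordinates, and the sign symmetry. -/

theorem IsEigenpair.eigenvalue_unique {m n : ℕ} {S : RTensor m n} {a b : ℝ} {v : Fin n → ℝ}
    (ha : IsEigenpair S a v) (hb : IsEigenpair S b v) : a = b := by
  have := congrArg (v ⬝ᵥ ·) (ha.1.symm.trans hb.1)
  simpa [ha.2] using this

namespace IsRegularSimplexFrame

variable {n m : ℕ} {w : Fin (n + 1) → Fin n → ℝ} {ev : ℝ} {v : Fin n → ℝ}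

theorem eigenvalue_eq (hm : 1 ≤ m)
    (h : IsEigenpair (simplexTensor m w) ev v) : ev = ∑ i, (w i ⬝ᵥ v) ^ m := by
  have := congrArg (· ⬝ᵥ v) h.1
  simp only [RTensor.applyVec_simplexTensor hm, smul_dotProduct, h.2, sum_dotProduct,
    smul_eq_mul, mul_one, ← pow_succ, Nat.sub_add_cancel hm] at this
  exact this.symm

theorem pow_dotProduct_eq (hw : IsRegularSimplexFrame w) (hn : n ≠ 0) (hm : 1 ≤ m)
    (h : IsEigenpair (simplexTensor m w) ev v) :
    ∃ c, ∀ i, (w i ⬝ᵥ v) ^ (m - 1) = ev * n / (n + 1) * (w i ⬝ᵥ v) + c := by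
  have h0 : (n : ℝ) ≠ 0 := by exact_mod_cast hn
  have h1 : (n : ℝ) + 1 ≠ 0 := by positivity
  refine ⟨(∑ i, (w i ⬝ᵥ v) ^ (m - 1)) / (n + 1), fun j => ?_⟩
  set c := (∑ i, (w i ⬝ᵥ v) ^ (m - 1)) / ((n : ℝ) + 1) with hc
  have hsum : ∑ i, ((w i ⬝ᵥ v) ^ (m - 1) - c) = 0 := by
    rw [Finset.sum_sub_distrib]
    simp [hc]
    field_simp
    ring
  have h2 : ∑ i, ((w i ⬝ᵥ v) ^ (m - 1) - c) • w i = ev • v := by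
    simp only [sub_smul, Finset.sum_sub_distrib, ← Finset.smul_sum, hw.sum_eq_zero hn, smul_zero,
      sub_zero, ← h.1, RTensor.applyVec_simplexTensor hm]
  have h3 := hw.dotProduct_sum_smul hn _ hsum j
  rw [h2, dotProduct_smul, smul_eq_mul] at h3
  field_simp at h3 ⊢
  linear_combination -h3

theorem transpose_jacobianAt (hm : 2 ≤ m) :
    (jacobianAt (simplexTensor m w) ev v)ᵀ = jacobianAt (simplexTensor m w) ev v := by
  simp [jacobianAt, RTensor.applyMat_simplexTensor hm, Matrix.transpose_sum, transpose_vecMulVec]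

theorem second_order_of_isRobustEigenpair (hw : IsRegularSimplexFrame w) (hn : n ≠ 0)
    (hm : 2 ≤ m) (hev : 0 < ev) (h : IsRobustEigenpair (simplexTensor m w) ev v)
    {y : Fin (n + 1) → ℝ} (hy : ∑ i, y i = 0) (hxy : ∑ i, (w i ⬝ᵥ v) * y i = 0) (hy0 : y ≠ 0) :
    ∑ i, (((m - 1 : ℕ) : ℝ) * (w i ⬝ᵥ v) ^ (m - 1 - 1) - ev * n / (n + 1)) * y i ^ 2 < 0 := by
  have h0 : (n : ℝ) ≠ 0 := by exact_mod_cast hn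
  have h1 : (n : ℝ) + 1 ≠ 0 := by positivity
  -- The vector whose frame coordinates are `y`. It is orthogonal to `v`, so the rank-one term of
  -- the Jacobian drops out.
  set u : Fin n → ℝ := ((n : ℝ) / (n + 1)) • ∑ i, y i • w i with hu
  have hwu (j) : w j ⬝ᵥ u = y j := by
    rw [hu, dotProduct_smul, hw.dotProduct_sum_smul hn y hy, smul_eq_mul]
    field_simp
  have hu0 : u ≠ 0 := fun h => hy0 (funext fun j => by rw [← hwu, h, dotProduct_zero]; rfl)
  have hvu : v ⬝ᵥ u = 0 := by
    have := hw.sum_dotProduct_mul_dotProduct hn v u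
    simp only [hwu, hxy] at this
    exact (mul_eq_zero.1 this.symm).resolve_left (by positivity)
  have huu : u ⬝ᵥ u = n / (n + 1) * ∑ i, y i ^ 2 := by
    have := hw.sum_dotProduct_mul_dotProduct hn u u
    simp only [hwu, ← pow_two] at this
    rw [this]
    field_simp
  have key := dotProduct_mulVec_lt_of_matrixSpectralRadius_lt_one (transpose_jacobianAt hm)
    h.2.2 hu0
  rw [jacobianAt, smul_mulVec, dotProduct_smul, sub_mulVec, dotProduct_sub, smul_mulVec,
    vecMulVec_mulVec, hvu, RTensor.applyMat_simplexTensor hm, dotProduct_sum_smul_mulVec_self,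
    huu] at key
  simp only [hwu, MulOpposite.op_zero, zero_smul, smul_zero, dotProduct_zero, sub_zero,
    smul_eq_mul] at key
  rw [div_mul_eq_mul_div, div_lt_iff₀ hev] at key
  simp only [sub_mul, Finset.sum_sub_distrib, mul_assoc, ← Finset.mul_sum]
  rw [Nat.cast_sub (by omega), Nat.cast_one, show m - 1 - 1 = m - 2 by omega, sub_neg]
  calc _ < _ := key
    _ = _ := by ring

theorem isEigenpair_neg (hm : 1 ≤ m) (h : IsEigenpair (simplexTensor m w) ev v) :
    IsEigenpair (simplexTensor m w) ((-1) ^ m * ev) (-v) := by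
  refine ⟨?_, by simpa using h.2⟩
  have h1 := h.1
  obtain ⟨k, rfl⟩ : ∃ k, m = k + 1 := ⟨m - 1, by omega⟩
  rw [RTensor.applyVec_simplexTensor hm] at h1 ⊢
  rw [smul_neg, ← neg_smul, pow_succ, show -((-1) ^ k * -1 * ev) = (-1) ^ k * ev by ring, mul_smul,
    ← h1, Finset.smul_sum]
  refine Finset.sum_congr rfl fun i _ => ?_
  rw [dotProduct_neg, neg_pow, Nat.add_sub_cancel, mul_smul]

/-- The matrix and the eigenvalue both acquire the factor `(-1) ^ m`, which cancels. -/
theorem jacobianAt_neg (hm : 2 ≤ m) :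
    jacobianAt (simplexTensor m w) ((-1) ^ m * ev) (-v) = jacobianAt (simplexTensor m w) ev v := by
  have h2 : (simplexTensor m w).applyMat (-v) = (-1 : ℝ) ^ m • (simplexTensor m w).applyMat v := by
    obtain ⟨k, rfl⟩ : ∃ k, m = k + 2 := ⟨m - 2, by omega⟩
    rw [RTensor.applyMat_simplexTensor hm, RTensor.applyMat_simplexTensor hm, Finset.smul_sum]
    refine Finset.sum_congr rfl fun i _ => ?_
    rw [dotProduct_neg, neg_pow, Nat.add_sub_cancel, mul_smul]
    congr 1
    ring
  have hsq : ((-1 : ℝ) ^ m) * (-1) ^ m = 1 := by rw [← mul_pow]; norm_num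
  have hinv : ((-1 : ℝ) ^ m)⁻¹ = (-1) ^ m := inv_eq_of_mul_eq_one_left hsq
  rw [jacobianAt, jacobianAt, h2, neg_vecMulVec, vecMulVec_neg, neg_neg, mul_smul, ← smul_sub,
    smul_smul]
  congr 1
  rw [div_mul_eq_mul_div, mul_comm, div_eq_mul_inv, mul_inv, hinv]
  linear_combination ((m : ℝ) - 1) * ev⁻¹ * hsq

theorem isRobustEigenpair_neg (hm : 2 ≤ m)
    (h : IsRobustEigenpair (simplexTensor m w) ev v) :
    IsRobustEigenpair (simplexTensor m w) ((-1) ^ m * ev) (-v) :=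
  ⟨isEigenpair_neg (by omega) h.1, mul_ne_zero (by simp) h.2.1, by
    rw [jacobianAt_neg hm]; exact h.2.2⟩

theorem eq_or_eq_neg_of_isRobustEigenpair (hw : IsRegularSimplexFrame w) (hn : 2 ≤ n)
    (hm : 3 ≤ m) (hev : 0 < ev) (h : IsRobustEigenpair (simplexTensor m w) ev v) :
    ∃ j, v = w j ∨ v = -w j := by
  have hn0 : n ≠ 0 := by omega
  have h0 : (n : ℝ) ≠ 0 := by exact_mod_cast hn0
  obtain ⟨c, hc⟩ := hw.pow_dotProduct_eq hn0 (by omega) h.1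
  have hsum := hw.sum_dotProduct_eq_zero hn0 v
  have hsq := hw.sum_dotProduct_mul_dotProduct hn0 v v
  rw [h.1.2, mul_one] at hsq
  have hx0 : (fun i => w i ⬝ᵥ v) ≠ 0 := by
    intro hx
    have hx' : ∀ i, w i ⬝ᵥ v = 0 := congrFun hx
    simp only [hx', mul_zero, Finset.sum_const_zero] at hsq
    have : (0 : ℝ) < ((n : ℝ) + 1) / n := by positivity
    linarith
  obtain ⟨j, a, ha⟩ := exists_eq_off_of_second_order (x := fun i => w i ⬝ᵥ v) (N := m - 1)
    (by simp; omega) (by omega) hc hsum hx0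
    (fun y h1 h2 h3 => hw.second_order_of_isRobustEigenpair hn0 (by omega) hev h h1 h2 h3)
  refine ⟨j, ?_⟩
  rcases simplex_coordinates_of_eq_off hn0 hsum hsq ha with ⟨hj, hi⟩ | ⟨hj, hi⟩
  · left
    refine hw.eq_of_dotProduct_eq hn0 fun i => ?_
    by_cases hij : i = j
    · rw [hij, hj, hw.1]
    · rw [hi i hij, hw.2 i j hij]
  · right
    refine hw.eq_of_dotProduct_eq hn0 fun i => ?_
    by_cases hij : i = j
    · rw [hij, hj, dotProduct_neg, hw.1]
    · rw [hi i hij, dotProduct_neg, hw.2 i j hij]; ring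

end IsRegularSimplexFrame

/-! ### The numerical threshold `7 ≤ n + m`. -/

theorem add_one_mul_add_one_lt_pow {n k : ℕ} (hn : 2 ≤ n) (hk : 4 ≤ k) :
    (n + 1) * k + 1 < n ^ k := by
  induction k, hk using Nat.le_induction with
  | base =>
    have : 8 * n ≤ n ^ 4 := by
      calc 8 * n = 2 ^ 3 * n := by norm_num
        _ ≤ n ^ 3 * n := by gcongr
        _ = n ^ 4 := by ring
    omega
  | succ k hk ih =>
    have h1 : 2 * n ^ k ≤ n ^ (k + 1) := by
      rw [pow_succ, mul_comm]; gcongr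
    have h2 : n + 1 ≤ (n + 1) * k := Nat.le_mul_of_pos_right _ (by omega)
    rw [mul_add, mul_one]
    omega

theorem seven_le_iff_of_odd {n m : ℕ} (hn : 2 ≤ n) (hm : 3 ≤ m) (ho : Odd m) :
    (n + 1) * (m - 1) + 1 < n ^ (m - 1) ↔ 7 ≤ n + m := by
  rcases Nat.lt_or_ge m 5 with h | h
  · have hm3 : m = 3 := by
      rcases ho with ⟨k, hk⟩; omega
    subst hm3
    constructor
    · intro h1
      by_contra h2
      have : n < 4 := by omega
      interval_cases n <;> norm_num at h1
    · intro h1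
      have : 4 * n ≤ n ^ 2 := by rw [pow_two]; gcongr; omega
      simp only [Nat.reduceSub]
      omega
  · exact iff_of_true (add_one_mul_add_one_lt_pow hn (by omega)) (by omega)

theorem seven_le_iff_of_even {n m : ℕ} (hn : 2 ≤ n) (hm : 3 ≤ m) (he : Even m) :
    (n + 1) * (m - 1) < n ^ (m - 1) + 1 ↔ 7 ≤ n + m := by
  rcases Nat.lt_or_ge m 5 with h | h
  · have hm4 : m = 4 := by
      rcases he with ⟨k, hk⟩; omega
    subst hm4
    constructor
    · intro h1
      by_contra h2
      have : n = 2 := by omega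
      subst this
      norm_num at h1
    · intro h1
      have : 9 * n ≤ n ^ 3 := by
        calc 9 * n = 3 ^ 2 * n := by norm_num
          _ ≤ n ^ 2 * n := by gcongr; omega
          _ = n ^ 3 := by ring
      simp only [Nat.reduceSub]
      omega
  · have := add_one_mul_add_one_lt_pow (k := m - 1) hn (by omega)
    exact iff_of_true (by omega) (by omega)

/-- The nonzero eigenvalue of the Jacobian at a frame vector. -/
noncomputable def simplexJacobianEigenvalue (n m : ℕ) : ℝ :=
  ((n : ℝ) + 1) * ((m : ℝ) - 1) / (1 + (-(n : ℝ)) ^ (m - 2) * (n : ℝ))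

theorem abs_simplexJacobianEigenvalue_of_odd {n m : ℕ} (hn : 2 ≤ n) (hm : 3 ≤ m) (ho : Odd m) :
    |simplexJacobianEigenvalue n m| =
      ((n : ℝ) + 1) * ((m : ℝ) - 1) / ((n : ℝ) ^ (m - 1) - 1) := by
  have hn' : (1 : ℝ) < n := by exact_mod_cast (by omega : 1 < n)
  have hm' : (3 : ℝ) ≤ m := by exact_mod_cast hm
  have h1 : 1 + (-(n : ℝ)) ^ (m - 2) * n = -((n : ℝ) ^ (m - 1) - 1) := by
    rw [(show Odd (m - 2) from Nat.Odd.sub_even (by omega) ho even_two).neg_pow,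
      show m - 1 = m - 2 + 1 by omega, pow_succ]
    ring
  have h2 : 1 < (n : ℝ) ^ (m - 1) := one_lt_pow₀ hn' (by omega)
  rw [simplexJacobianEigenvalue, h1, abs_div, abs_neg, abs_of_pos (sub_pos.2 h2),
    abs_of_nonneg (mul_nonneg (by positivity) (by linarith))]

theorem abs_simplexJacobianEigenvalue_of_even {n m : ℕ} (hm : 3 ≤ m) (he : Even m) :
    |simplexJacobianEigenvalue n m| =
      ((n : ℝ) + 1) * ((m : ℝ) - 1) / (1 + (n : ℝ) ^ (m - 1)) := by
  have hm' : (3 : ℝ) ≤ m := by exact_mod_cast hm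
  have h1 : 1 + (-(n : ℝ)) ^ (m - 2) * n = 1 + (n : ℝ) ^ (m - 1) := by
    rw [(show Even (m - 2) from (Nat.even_sub (by omega)).2 (by simp [he])).neg_pow,
      show m - 1 = m - 2 + 1 by omega, pow_succ]
  rw [simplexJacobianEigenvalue, h1, abs_of_nonneg]
  exact div_nonneg (mul_nonneg (by positivity) (by linarith)) (by positivity)

theorem abs_simplexJacobianEigenvalue_lt_one_iff {n m : ℕ} (hn : 2 ≤ n) (hm : 3 ≤ m) :
    |simplexJacobianEigenvalue n m| < 1 ↔ 7 ≤ n + m := by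
  have hn' : (1 : ℝ) < n := by exact_mod_cast (by omega : 1 < n)
  have hc : ((m - 1 : ℕ) : ℝ) = (m : ℝ) - 1 := by rw [Nat.cast_sub (by omega), Nat.cast_one]
  rcases Nat.even_or_odd m with he | ho
  · rw [abs_simplexJacobianEigenvalue_of_even hm he, div_lt_one (by positivity),
      ← seven_le_iff_of_even hn hm he, ← hc, add_comm (1 : ℝ)]
    exact_mod_cast Iff.rfl
  · have h2 : 1 < (n : ℝ) ^ (m - 1) := one_lt_pow₀ hn' (by omega)
    rw [abs_simplexJacobianEigenvalue_of_odd hn hm ho, div_lt_one (sub_pos.2 h2),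
      ← seven_le_iff_of_odd hn hm ho, ← hc, lt_sub_iff_add_lt]
    exact_mod_cast Iff.rfl

/-- Keeps the frame eigenvalue positive and the denominator of `simplexJacobianEigenvalue` nonzero.
-/
theorem four_le_abs_neg_pow_mul {n m : ℕ} (hn : 2 ≤ n) (hm : 3 ≤ m) :
    4 ≤ |(-(n : ℝ)) ^ (m - 2) * n| := by
  have hn' : (2 : ℝ) ≤ n := by exact_mod_cast hn
  rw [abs_mul, abs_pow, abs_neg, Nat.abs_cast]
  have : (n : ℝ) ≤ (n : ℝ) ^ (m - 2) := le_self_pow₀ (by linarith) (by omega)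
  nlinarith

theorem simplexEigenvalue_eq {n m : ℕ} (hn : 2 ≤ n) (hm : 3 ≤ m) :
    1 + (n : ℝ) / (-(n : ℝ)) ^ m = 1 + 1 / ((-(n : ℝ)) ^ (m - 2) * n) := by
  have h0 : (n : ℝ) ≠ 0 := by positivity
  have hq : (-(n : ℝ)) ^ (m - 2) ≠ 0 := pow_ne_zero _ (neg_ne_zero.2 h0)
  have : (-(n : ℝ)) ^ m = (-(n : ℝ)) ^ (m - 2) * n ^ 2 := by
    conv_lhs => rw [show m = m - 2 + 2 by omega, pow_add, neg_sq]
  rw [this]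
  field_simp

theorem simplexEigenvalue_pos {n m : ℕ} (hn : 2 ≤ n) (hm : 3 ≤ m) :
    0 < 1 + (n : ℝ) / (-(n : ℝ)) ^ m := by
  have h := four_le_abs_neg_pow_mul hn hm
  rw [simplexEigenvalue_eq hn hm]
  set t := (-(n : ℝ)) ^ (m - 2) * n
  have h1 : |1 / t| < 1 := by
    rw [abs_div, abs_one, div_lt_one (by linarith)]; linarith
  linarith [(abs_lt.1 h1).1]

/-! ### Frame vectors as eigenvectors, and the classification. -/

namespace IsRegularSimplexFrame

variable {n m : ℕ} {w : Fin (n + 1) → Fin n → ℝ}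

theorem isEigenpair_frame (hw : IsRegularSimplexFrame w) (hn : n ≠ 0) (hm : 1 ≤ m)
    (j : Fin (n + 1)) :
    IsEigenpair (simplexTensor m w) (1 + (n : ℝ) / (-(n : ℝ)) ^ m) (w j) := by
  refine ⟨?_, hw.1 j⟩
  have h0 : (n : ℝ) ≠ 0 := by exact_mod_cast hn
  -- A constant coefficient, which `∑ w i = 0` removes, plus a correction at `j` alone.
  have h1 (i) : (w i ⬝ᵥ w j) ^ (m - 1) • w i =
      (1 / (-(n : ℝ)) ^ (m - 1)) • w i +
        if i = j then (1 - 1 / (-(n : ℝ)) ^ (m - 1)) • w i else 0 := by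
    split_ifs with h
    · rw [h, hw.1, one_pow, ← add_smul]; congr 1; ring
    · rw [hw.2 i j h, add_zero, ← _root_.one_div_pow]; congr 2; field_simp
  rw [RTensor.applyVec_simplexTensor hm]
  simp only [h1, Finset.sum_add_distrib, ← Finset.smul_sum, hw.sum_eq_zero hn, smul_zero, zero_add,
    Finset.sum_ite_eq', Finset.mem_univ, if_true]
  congr 1
  obtain ⟨k, rfl⟩ : ∃ k, m = k + 1 := ⟨m - 1, by omega⟩
  have hq : (-(n : ℝ)) ^ k ≠ 0 := pow_ne_zero _ (neg_ne_zero.2 h0)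
  rw [Nat.add_sub_cancel, pow_succ]
  field_simp
  ring

theorem jacobianAt_frame (hw : IsRegularSimplexFrame w) (hn : 2 ≤ n) (hm : 3 ≤ m)
    (j : Fin (n + 1)) :
    jacobianAt (simplexTensor m w) (1 + (n : ℝ) / (-(n : ℝ)) ^ m) (w j) =
      simplexJacobianEigenvalue n m • (1 - vecMulVec (w j) (w j)) := by
  have hn0 : n ≠ 0 := by omega
  have h0 : (n : ℝ) ≠ 0 := by exact_mod_cast hn0
  have hpos := simplexEigenvalue_pos hn hm
  have habs := four_le_abs_neg_pow_mul hn hm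
  rw [jacobianAt, simplexJacobianEigenvalue]
  rw [simplexEigenvalue_eq hn hm] at hpos ⊢
  have hq : (-(n : ℝ)) ^ (m - 2) ≠ 0 := pow_ne_zero _ (neg_ne_zero.2 h0)
  have h1 (i) : (w i ⬝ᵥ w j) ^ (m - 2) • vecMulVec (w i) (w i) =
      (1 / (-(n : ℝ)) ^ (m - 2)) • vecMulVec (w i) (w i) +
        if i = j then (1 - 1 / (-(n : ℝ)) ^ (m - 2)) • vecMulVec (w i) (w i) else 0 := by
    split_ifs with h
    · rw [h, hw.1, one_pow, ← add_smul]; congr 1; ring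
    · rw [hw.2 i j h, add_zero, ← _root_.one_div_pow]; congr 2; field_simp
  rw [RTensor.applyMat_simplexTensor (by omega)]
  simp only [h1, Finset.sum_add_distrib, ← Finset.smul_sum, hw.sum_vecMulVec hn0,
    Finset.sum_ite_eq', Finset.mem_univ, if_true]
  generalize (-(n : ℝ)) ^ (m - 2) = q at *
  have hne : 1 + q * n ≠ 0 := by
    intro h
    rw [show q * (n : ℝ) = -1 by linarith] at habs
    norm_num at habs
  rw [add_sub_assoc, ← sub_smul, smul_add, smul_smul, smul_smul, smul_smul, smul_sub,
    sub_eq_add_neg (_ • (1 : Matrix (Fin n) (Fin n) ℝ)), ← neg_smul]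
  have hev : 1 + 1 / (q * n) = (1 + q * n) / (q * n) := by field_simp; ring
  rw [hev]
  congr 2
  · field_simp
  · field_simp
    ring

theorem matrixSpectralRadius_jacobianAt_frame (hw : IsRegularSimplexFrame w) (hn : 2 ≤ n)
    (hm : 3 ≤ m) (j : Fin (n + 1)) :
    matrixSpectralRadius (jacobianAt (simplexTensor m w) (1 + (n : ℝ) / (-(n : ℝ)) ^ m) (w j)) =
      ENNReal.ofReal |simplexJacobianEigenvalue n m| := by
  rw [hw.jacobianAt_frame hn hm, matrixSpectralRadius_smul_one_sub_vecMulVec hn _ _ (hw.1 j)]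

theorem isRobustEigenpair_frame_iff (hw : IsRegularSimplexFrame w) (hn : 2 ≤ n) (hm : 3 ≤ m)
    (j : Fin (n + 1)) :
    IsRobustEigenpair (simplexTensor m w) (1 + (n : ℝ) / (-(n : ℝ)) ^ m) (w j) ↔ 7 ≤ n + m := by
  rw [← abs_simplexJacobianEigenvalue_lt_one_iff hn hm, IsRobustEigenpair,
    hw.matrixSpectralRadius_jacobianAt_frame hn hm, ENNReal.ofReal_lt_one]
  exact ⟨fun h => h.2.2, fun h =>
    ⟨hw.isEigenpair_frame (by omega) (by omega) j, (simplexEigenvalue_pos hn hm).ne', h⟩⟩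

theorem seven_le_of_isRobustEigenpair_frame (hw : IsRegularSimplexFrame w) (hn : 2 ≤ n)
    (hm : 3 ≤ m) {ev : ℝ} {j : Fin (n + 1)}
    (h : IsRobustEigenpair (simplexTensor m w) ev (w j)) : 7 ≤ n + m := by
  have := h.1.eigenvalue_unique (hw.isEigenpair_frame (by omega) (by omega) j)
  rw [this] at h
  exact (hw.isRobustEigenpair_frame_iff hn hm j).1 h

theorem robust_pos_iff (hw : IsRegularSimplexFrame w) (hn : 2 ≤ n) (hm : 3 ≤ m)
    (v : Fin n → ℝ) : (∃ ev : ℝ, 0 < ev ∧ IsRobustEigenpair (simplexTensor m w) ev v) ↔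
      (7 ≤ n + m ∧ ∃ j, v = w j ∨ (Even m ∧ v = -w j)) := by
  have hpos := simplexEigenvalue_pos hn hm
  constructor
  · rintro ⟨ev, hev, h⟩
    obtain ⟨j, rfl | rfl⟩ := hw.eq_or_eq_neg_of_isRobustEigenpair hn hm hev h
    · exact ⟨hw.seven_le_of_isRobustEigenpair_frame hn hm h, j, Or.inl rfl⟩
    · have h' := isRobustEigenpair_neg (by omega) h
      rw [neg_neg] at h'
      refine ⟨hw.seven_le_of_isRobustEigenpair_frame hn hm h', j, Or.inr ⟨?_, rfl⟩⟩
      -- For odd `m` the eigenvalue at `-w j` is the negative of the positive one at `w j`.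
      rw [← Nat.not_odd_iff_even]
      intro ho
      have := h'.1.eigenvalue_unique (hw.isEigenpair_frame (by omega) (by omega) j)
      rw [ho.neg_one_pow] at this
      linarith
  · rintro ⟨h7, j, rfl | ⟨he, rfl⟩⟩
    · exact ⟨_, hpos, (hw.isRobustEigenpair_frame_iff hn hm j).2 h7⟩
    · refine ⟨_, ?_, isRobustEigenpair_neg (by omega)
        ((hw.isRobustEigenpair_frame_iff hn hm j).2 h7)⟩
      rwa [he.neg_one_pow, one_mul]

theorem isRobustEigenvector_iff (hw : IsRegularSimplexFrame w) (hn : 2 ≤ n) (hm : 3 ≤ m)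
    (v : Fin n → ℝ) : IsRobustEigenvector (simplexTensor m w) v ↔
      (7 ≤ n + m ∧ ∃ j, v = w j ∨ v = -w j) := by
  constructor
  · rintro ⟨ev, h⟩
    rcases lt_or_gt_of_ne h.2.1 with hneg | hpos
    · have ho : Odd m := by
        rw [← Nat.not_even_iff_odd]
        intro he
        have : 0 ≤ ∑ i, (w i ⬝ᵥ v) ^ m := Finset.sum_nonneg fun i _ => he.pow_nonneg _
        rw [← eigenvalue_eq (by omega) h.1] at this
        linarith
      obtain ⟨h7, j, hj⟩ := (hw.robust_pos_iff hn hm (-v)).1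
        ⟨_, by rw [ho.neg_one_pow]; linarith, isRobustEigenpair_neg (by omega) h⟩
      refine ⟨h7, j, ?_⟩
      rcases hj with hj | ⟨-, hj⟩
      · exact Or.inr (by rw [← hj, neg_neg])
      · exact Or.inl (neg_injective hj)
    · obtain ⟨h7, j, hj⟩ := (hw.robust_pos_iff hn hm v).1 ⟨ev, hpos, h⟩
      exact ⟨h7, j, hj.imp_right And.right⟩
  · rintro ⟨h7, j, rfl | rfl⟩
    · exact ⟨_, (hw.isRobustEigenpair_frame_iff hn hm j).2 h7⟩
    · exact ⟨_, isRobustEigenpair_neg (by omega) ((hw.isRobustEigenpair_frame_iff hn hm j).2 h7)⟩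

theorem roots_charpoly_jacobianAt_frame (hw : IsRegularSimplexFrame w) (hn : 2 ≤ n)
    (hm : 3 ≤ m) (j : Fin (n + 1)) :
    (jacobianAt (simplexTensor m w) (1 + (n : ℝ) / (-(n : ℝ)) ^ m) (w j)).charpoly.roots =
      0 ::ₘ Multiset.replicate (n - 1) (simplexJacobianEigenvalue n m) := by
  rw [hw.jacobianAt_frame hn hm, charpoly_smul_one_sub_vecMulVec (by omega) _ _ (hw.1 j),
    Polynomial.roots_mul (mul_ne_zero Polynomial.X_ne_zero
      (pow_ne_zero _ (Polynomial.X_sub_C_ne_zero _))), Polynomial.roots_X, Polynomial.roots_pow,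
    Polynomial.roots_X_sub_C, Multiset.nsmul_singleton, Multiset.singleton_add]

end IsRegularSimplexFrame

theorem mainTheorem2 (n m : ℕ) (hn : 2 ≤ n) (hm : 3 ≤ m)
    (w : Fin (n + 1) → Fin n → ℝ) (hw : IsRegularSimplexFrame w) :
    -- the robust eigenvectors are precisely the frame vectors, up to sign
    (∀ v : Fin n → ℝ, IsRobustEigenvector (simplexTensor m w) v ↔
      (7 ≤ n + m ∧ ∃ j, v = w j ∨ v = -w j)) ∧
    -- the same with the sign normalization that the eigenvalue is positive
    (∀ v : Fin n → ℝ, (∃ ev : ℝ, 0 < ev ∧ IsRobustEigenpair (simplexTensor m w) ev v) ↔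
      (7 ≤ n + m ∧ ∃ j, v = w j ∨ (Even m ∧ v = -w j))) ∧
    -- the Jacobian at the frame vectors: eigenvalues with multiplicity, and spectral radius
    (∀ j : Fin (n + 1), ∀ ev : ℝ, ev = 1 + (n : ℝ) / (-(n : ℝ)) ^ m →
      0 < ev ∧
      IsEigenpair (simplexTensor m w) ev (w j) ∧
      (jacobianAt (simplexTensor m w) ev (w j)).charpoly.roots =
        0 ::ₘ Multiset.replicate (n - 1)
          (((n : ℝ) + 1) * ((m : ℝ) - 1) / (1 + (-(n : ℝ)) ^ (m - 2) * (n : ℝ))) ∧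
      (Odd m → matrixSpectralRadius (jacobianAt (simplexTensor m w) ev (w j)) =
        ENNReal.ofReal (((n : ℝ) + 1) * ((m : ℝ) - 1) / ((n : ℝ) ^ (m - 1) - 1))) ∧
      (Even m → matrixSpectralRadius (jacobianAt (simplexTensor m w) ev (w j)) =
        ENNReal.ofReal (((n : ℝ) + 1) * ((m : ℝ) - 1) / (1 + (n : ℝ) ^ (m - 1))))) := by
  refine ⟨hw.isRobustEigenvector_iff hn hm, hw.robust_pos_iff hn hm, ?_⟩
  rintro j ev rfl
  refine ⟨simplexEigenvalue_pos hn hm, hw.isEigenpair_frame (by omega) (by omega) j,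
    hw.roots_charpoly_jacobianAt_frame hn hm j, fun ho => ?_, fun he => ?_⟩
  · rw [hw.matrixSpectralRadius_jacobianAt_frame hn hm,
      abs_simplexJacobianEigenvalue_of_odd hn hm ho]
  · rw [hw.matrixSpectralRadius_jacobianAt_frame hn hm,
      abs_simplexJacobianEigenvalue_of_even hm he]
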